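/- All logarithms are to base $2$ and $\exp(x)=2^x$. Let $\mathcal H$ be a complex Hilbert space of finite dimension $d$, let $\rho>0$ be a positive definite density operator on $\mathcal H$ ($\operatorname{Tr}\rho=1$), and let $\mathbf a=(a_j)_{j=1,\dots,m}$ be a POVM on $\mathcal H$ (that is, $a_j\ge 0$ and $\sum_j a_j=\mathbb 1$). Put $\lambda_j=\operatorname{Tr}(\rho a_j)$, $\hat\rho_j=\frac{1}{\lambda_j}\sqrt\rho\,a_j\sqrt\rho$, $\lambda_0=\min_j\lambda_j$, and let $H(\sigma)=-\operatorname{Tr}\sigma\log\sigma$ denote the von Neumann entropy. For a POVM $\mathbf A=(A_\mu)_{\mu=1,\dots,M}$ on $\mathcal H^{\otimes l}$ whose outcomes $\mu$ are labelled by tuples of guesses $j^l_\mu=(j_{\mu1},\dots,j_{\mu l})\in\{1,\dots,m\}^l$, define its marginals, for $k=1,\dots,l$ and $j=1,\dots,m$, by $$A^{(k)}_j=\operatorname{Tr}_{\neq k}\Bigl(\bigl(\rho^{\otimes[l]\setminus k}\otimes\mathbb 1_k\bigr)\sum_{\mu:\,j_{\mu k}=j}A_\mu\Bigr),$$ where $\operatorname{Tr}_{\neq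 k}$ is the partial trace over all tensor factors except the $k$-th. Let $\|\cdot\|$ be the operator norm. 1. Let $0<\epsilon\le(\lambda_0/2)^2$. Then for every $l$, every POVM $\mathbf A=(A_\mu)_{\mu=1,\dots,M}$ on $\mathcal H^{\otimes l}$, labelled as above, such that $$\forall k\quad \sum_j\|A^{(k)}_j-a_j\|\le\epsilon$$ has $$M\ \ge\ \exp\Bigl(l\Bigl(H(\rho)-\sum_j\lambda_jH(\hat\rho_j)+\frac{3\epsilon}{\lambda_0^2}\log\frac{2\epsilon}{\lambda_0^2d}\Bigr)\Bigr)$$ outcomes. 2. Consequently the entropy defect $H(\rho)-\sum_j\lambda_jH(\hat\rho_j)$ is an asymptotically optimal rate, in the sense that no smaller rate suffices: if $\lambda_0>0$, then for every $\delta>0$ there is $\epsilon_0>0$ such that for every $l$, every labelled POVM $\mathbf A$ on $\mathcal H^{\otimes l}$ with $\sum_j\|A^{(k)}_j-a_j\|\le\epsilon_0$ for all $k$ has $M\ge\exp\bigl(l(H(\rho)-\sum_j\lambda_jH(\hat\rho_j)-\delta)\bigr)$ outcomes. -/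

import Mathlib

open scoped Matrix ComplexOrder

noncomputable section

namespace MeasurementCompression

/-- A POVM with finitely many outcomes `μ : κ` on the Hilbert space `ℂ^n`: a family of positive
semidefinite operators that sums to the identity. -/
structure IsPOVM {κ n : Type*} [Fintype κ] [Fintype n] [DecidableEq n]
    (A : κ → Matrix n n ℂ) : Prop where
  posSemidef : ∀ μ, (A μ).PosSemidef
  sum_eq_one : ∑ μ, A μ = 1

/-- The operator (sup) norm of a matrix acting on the Euclidean space `ℂ^n`. -/
def opNorm {n : Type*} [Fintype n] [DecidableEq n] (X : Matrix n n ℂ) : ℝ :=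
  ‖Matrix.toEuclideanCLM (n := n) (𝕜 := ℂ) X‖

/-- The von Neumann entropy `H(σ) = -Tr σ log σ`, in bits. The logarithm is taken in the functional
calculus; Lean's `log 0 = 0` implements the convention `0 log 0 = 0`. -/
def entropy {n : Type*} [Fintype n] [DecidableEq n] (σ : Matrix n n ℂ) : ℝ :=
  -(σ * cfc (Real.logb 2) σ).trace.re

/-- The positive square root of a positive semidefinite matrix. -/
def msqrt {n : Type*} [Fintype n] [DecidableEq n] (σ : Matrix n n ℂ) : Matrix n n ℂ :=
  cfc Real.sqrt σ

/-- The tensor product `B 1 ⊗ ⋯ ⊗ B l`, as an operator on `(ℂ^n)^{⊗ l}`, whose standard orthonormal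
basis is indexed by the tuples `Fin l → n`. -/
def tensor {l : ℕ} {n : Type*} (B : Fin l → Matrix n n ℂ) : Matrix (Fin l → n) (Fin l → n) ℂ :=
  Matrix.of fun x y => ∏ i, B i (x i) (y i)

/-- The partial trace `Tr_{≠ k}` over all tensor factors but the `k`-th. The sum over the tuples `x`
with `x k = s` is a sum over all values of the coordinates different from `k`. -/
def partialTrace {l : ℕ} {n : Type*} [Fintype n] [DecidableEq n] (k : Fin l)
    (X : Matrix (Fin l → n) (Fin l → n) ℂ) : Matrix n n ℂ :=
  Matrix.of fun s t => ∑ x : Fin l → n with x k = s, X x (Function.update x k t)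

/-- The marginal
`A^{(k)}_j = Tr_{≠ k} ((ρ^{⊗ [l] \ k} ⊗ 1_k) ∑_{μ : j_{μ k} = j} A_μ)` of a POVM `A` on
`(ℂ^n)^{⊗ l}`, whose outcome `μ` carries the tuple of guesses `guess μ`. -/
def marginal {l : ℕ} {κ n J : Type*} [Fintype κ] [Fintype n] [DecidableEq n] [DecidableEq J]
    (ρ : Matrix n n ℂ) (A : κ → Matrix (Fin l → n) (Fin l → n) ℂ) (guess : κ → Fin l → J)
    (k : Fin l) (j : J) : Matrix n n ℂ :=
  partialTrace k (tensor (Function.update (fun _ => ρ) k 1) * ∑ μ with guess μ k = j, A μ)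

/-- The outcome probability `λ_j = Tr (ρ a_j)`. -/
def outcomeProb {n J : Type*} [Fintype n] (ρ : Matrix n n ℂ) (a : J → Matrix n n ℂ) (j : J) : ℝ :=
  (ρ * a j).trace.re

/-- `λ_0 = min_j λ_j` (for a finite nonempty `J`). -/
def minProb {n J : Type*} [Fintype n] (ρ : Matrix n n ℂ) (a : J → Matrix n n ℂ) : ℝ :=
  ⨅ j, outcomeProb ρ a j

/-- The state `ρ̂_j = √ρ a_j √ρ / Tr (ρ a_j)` of the canonical ensemble. -/
def canonicalState {n J : Type*} [Fintype n] [DecidableEq n] (ρ : Matrix n n ℂ)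
    (a : J → Matrix n n ℂ) (j : J) : Matrix n n ℂ :=
  (outcomeProb ρ a j)⁻¹ • (msqrt ρ * a j * msqrt ρ)

/-- The entropy defect `H(ρ) - ∑_j λ_j H(ρ̂_j)` of the canonical ensemble. -/
def entropyDefect {n J : Type*} [Fintype n] [DecidableEq n] [Fintype J] (ρ : Matrix n n ℂ)
    (a : J → Matrix n n ℂ) : ℝ :=
  entropy ρ - ∑ j, outcomeProb ρ a j * entropy (canonicalState ρ a j)

end MeasurementCompression

end

/-!
Klein's inequality bounds `H(R)`, for `R = ρ^{⊗ l}`, by the cross entropy of `R` relative to any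
positive operator of trace at most one. Take for it the uniform mixture of the product operators
`⊗_k τ_{j_{μ k}}` over the outcomes `μ`. Split `R = ∑_μ √R A_μ √R`; since the logarithm is operator
monotone, replacing the mixture by its `μ`-th term in the `μ`-th summand costs only `log M`. The
logarithm of a product splits into local terms, so what remains is, site by site, the pairing of the
marginals `A^{(k)}_j` with the observables `√ρ (-log τ_j) √ρ`. If the marginals were exactly `a_j`
and `τ_j` were `ρ̂_j`, this would be `∑_j λ_j H(ρ̂_j)`. Taking for `τ_j` a slightly depolarized
`ρ̂_j` keeps the observables bounded, which controls the deviation of the marginals. Depolarizing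
with parameter `2 ε / λ_0²` gives the explicit bound, with parameter `ε` the asymptotic one.
-/

noncomputable section

namespace MeasurementCompression

open scoped MatrixOrder Matrix.Norms.L2Operator

section FunctionalCalculus

variable {n : Type*} [Fintype n] [DecidableEq n]

/-- The `⋆`-homomorphism `h ↦ U * diagonal h * U⋆` onto the operators that are diagonal in the
orthonormal basis given by the columns of the unitary `U`. The functional calculus acts entrywise on
`h`. -/
def conjDiagonal (U : Matrix.unitaryGroup n ℂ) : (n → ℂ) →⋆ₐ[ℂ] Matrix n n ℂ :=
  (Unitary.conjStarAlgAut ℂ (Matrix n n ℂ) U : Matrix n n ℂ →⋆ₐ[ℂ] Matrix n n ℂ).comp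
    { Matrix.diagonalAlgHom ℂ with
      map_star' := fun h => (Matrix.diagonal_conjTranspose h).symm }

theorem conjDiagonal_apply (U : Matrix.unitaryGroup n ℂ) (h : n → ℂ) :
    conjDiagonal U h = (U : Matrix n n ℂ) * Matrix.diagonal h * star (U : Matrix n n ℂ) :=
  rfl

theorem cfc_conjDiagonal (U : Matrix.unitaryGroup n ℂ) (r : n → ℝ) (f : ℝ → ℝ) :
    cfc f (conjDiagonal U fun i => (r i : ℂ)) = conjDiagonal U fun i => (f (r i) : ℂ) := by
  have : ContinuousFunctionalCalculus ℝ (n → ℂ) IsSelfAdjoint :=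
    IsSelfAdjoint.instContinuousFunctionalCalculus
  have hr : IsSelfAdjoint fun i => (r i : ℂ) := funext fun i => Complex.conj_ofReal (r i)
  have hspec : (⋃ i, spectrum ℝ (r i : ℂ)).Finite :=
    Set.finite_iUnion fun i => by
      rw [← Complex.coe_algebraMap, spectrum.scalar_eq]
      exact Set.finite_singleton _
  have hf : ContinuousOn f (⋃ i, spectrum ℝ (r i : ℂ)) := hspec.continuousOn f
  rw [← StarAlgHom.map_cfc (conjDiagonal U) f (fun i => (r i : ℂ)) (by rwa [Pi.spectrum_eq])
    (conjDiagonal U).toLinearMap.continuous_of_finiteDimensional hr (hr.map (conjDiagonal U)),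
    cfc_map_pi (S := ℝ) (q := fun _ => IsSelfAdjoint) f _ hf hr
      fun i => Complex.conj_ofReal (r i)]
  simp only [← Complex.coe_algebraMap, cfc_algebraMap]

theorem cfc_eq_conjDiagonal {A : Matrix n n ℂ} (hA : A.IsHermitian) (f : ℝ → ℝ) :
    cfc f A = conjDiagonal hA.eigenvectorUnitary fun i => (f (hA.eigenvalues i) : ℂ) :=
  hA.cfc_eq f

theorem mul_cfc {A : Matrix n n ℂ} (hA : A.IsHermitian) (f : ℝ → ℝ) :
    A * cfc f A = cfc (fun x => x * f x) A := by
  rw [cfc_mul (fun x => x) f A (by fun_prop) (A.finite_real_spectrum.continuousOn f),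
    cfc_id' ℝ A hA.isSelfAdjoint]

theorem spectrum_subset_Icc_of_trace_le_one {σ : Matrix n n ℂ} (hσ : σ.PosSemidef)
    (hσ_tr : σ.trace.re ≤ 1) : spectrum ℝ σ ⊆ Set.Icc 0 1 := by
  rw [hσ.isHermitian.spectrum_real_eq_range_eigenvalues]
  rintro _ ⟨i, rfl⟩
  refine ⟨hσ.eigenvalues_nonneg i, le_trans ?_ hσ_tr⟩
  rw [hσ.isHermitian.trace_eq_sum_eigenvalues, Complex.re_sum]
  exact Finset.single_le_sum (fun j _ => hσ.eigenvalues_nonneg j) (Finset.mem_univ i)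

theorem logb_smul_one_add_cfc_logb_le {S T : Matrix n n ℂ} {c : ℝ} (hS : S.PosDef) (hc : 0 < c)
    (hST : c • S ≤ T) :
    Real.logb 2 c • (1 : Matrix n n ℂ) + cfc (Real.logb 2) S ≤ cfc (Real.logb 2) T := by
  have logb_eq_smul_log (X : Matrix n n ℂ) :
      cfc (Real.logb 2) X = (Real.log 2)⁻¹ • CFC.log X := by
    rw [CFC.log, ← cfc_smul (hf := X.finite_real_spectrum.continuousOn _)]
    exact congrArg (cfc · X) (funext fun x => div_eq_inv_mul (Real.log x) (Real.log 2))
  have hlog : CFC.log (c • S) ≤ CFC.log T :=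
    CFC.log_le_log hST (Matrix.isStrictlyPositive_iff_posDef.2 (hS.smul hc))
  rw [CFC.log_smul' S hc (Matrix.isStrictlyPositive_iff_posDef.2 hS),
    Algebra.algebraMap_eq_smul_one] at hlog
  rw [logb_eq_smul_log, logb_eq_smul_log, Real.logb, div_eq_inv_mul, mul_smul, ← smul_add]
  exact smul_le_smul_of_nonneg_left hlog (inv_nonneg.2 (Real.log_nonneg one_le_two))

end FunctionalCalculus

section Trace

variable {n : Type*} [Fintype n]

theorem nonempty_of_trace_eq_one {R : Type*} [Semiring R] [Nontrivial R] {ρ : Matrix n n R}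
    (hρ_tr : ρ.trace = 1) : Nonempty n := by
  by_contra h
  rw [not_nonempty_iff] at h
  simp [Matrix.trace] at hρ_tr

theorem re_trace_mul_nonneg {A N : Matrix n n ℂ} (hA : A.PosSemidef) (hN : N.PosSemidef) :
    0 ≤ (A * N).trace.re := by
  classical
  obtain ⟨B, rfl⟩ := CStarAlgebra.nonneg_iff_eq_star_mul_self.1 hA.nonneg
  rw [mul_assoc, Matrix.trace_mul_comm]
  exact (Complex.nonneg_iff.1 (hN.mul_mul_conjTranspose_same B).trace_nonneg).1

theorem re_trace_mul_le_re_trace_mul {A X Y : Matrix n n ℂ} (hA : A.PosSemidef) (hXY : X ≤ Y) :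
    (A * X).trace.re ≤ (A * Y).trace.re := by
  have h := re_trace_mul_nonneg hA (Matrix.le_iff.1 hXY)
  rwa [mul_sub, Matrix.trace_sub, Complex.sub_re, sub_nonneg] at h

variable [DecidableEq n]

theorem re_trace_mul_le_opNorm_mul (D : Matrix n n ℂ) {N : Matrix n n ℂ} (hN : N.PosSemidef) :
    (D * N).trace.re ≤ opNorm D * N.trace.re := by
  have hre : (D * N).trace.re = (N * (realPart D : Matrix n n ℂ)).trace.re := by
    have hstar : (N * star D).trace = star (D * N).trace := by
      rw [← Matrix.trace_conjTranspose, Matrix.conjTranspose_mul, hN.isHermitian.eq,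
        Matrix.star_eq_conjTranspose]
    rw [realPart_apply_coe, mul_smul_comm, mul_add, Matrix.trace_smul, Matrix.trace_add, hstar,
      Matrix.trace_mul_comm N D]
    simp
    ring
  have hle : (realPart D : Matrix n n ℂ) ≤ algebraMap ℝ _ (opNorm D) :=
    (realPart D).2.le_algebraMap_norm_self.trans
      (algebraMap_mono _ (realPart.norm_le D))
  rw [hre]
  refine (re_trace_mul_le_re_trace_mul hN hle).trans_eq ?_
  rw [Algebra.algebraMap_eq_smul_one, mul_smul_comm, mul_one, Matrix.trace_smul, Complex.smul_re,
    smul_eq_mul]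

theorem sum_re_trace_mul_le_mul {J : Type*} [Fintype J] {D S : J → Matrix n n ℂ} {c ε : ℝ}
    (hD : ∑ j, opNorm (D j) ≤ ε) (hS : ∀ j, (S j).PosSemidef) (hS_tr : ∀ j, (S j).trace.re ≤ c)
    (hc : 0 ≤ c) : ∑ j, (D j * S j).trace.re ≤ ε * c :=
  calc ∑ j, (D j * S j).trace.re ≤ ∑ j, opNorm (D j) * c :=
        Finset.sum_le_sum fun j _ => (re_trace_mul_le_opNorm_mul _ (hS j)).trans
          (mul_le_mul_of_nonneg_left (hS_tr j) (norm_nonneg _))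
    _ = (∑ j, opNorm (D j)) * c := (Finset.sum_mul ..).symm
    _ ≤ ε * c := mul_le_mul_of_nonneg_right hD hc

theorem trace_conjDiagonal_mul_conjDiagonal (U V : Matrix.unitaryGroup n ℂ) (r t : n → ℂ) :
    (conjDiagonal U r * conjDiagonal V t).trace =
      ∑ i, ∑ j, (Complex.normSq ((star (U : Matrix n n ℂ) * (V : Matrix n n ℂ)) i j) : ℂ) *
        (r i * t j) := by
  set W := star (U : Matrix n n ℂ) * (V : Matrix n n ℂ) with hW
  have hcycle : (conjDiagonal U r * conjDiagonal V t).trace =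
      (Matrix.diagonal r * W * Matrix.diagonal t * star W).trace := by
    rw [conjDiagonal_apply, conjDiagonal_apply, mul_assoc (U : Matrix n n ℂ), mul_assoc,
      Matrix.trace_mul_comm, hW, star_mul, star_star]
    simp only [mul_assoc]
  rw [hcycle, Matrix.trace]
  refine Finset.sum_congr rfl fun i _ => ?_
  rw [Matrix.diag_apply, Matrix.mul_apply]
  refine Finset.sum_congr rfl fun j _ => ?_
  rw [Matrix.mul_diagonal, Matrix.diagonal_mul, Matrix.star_apply, ← Complex.mul_conj,
    Complex.star_def]
  ring

/-- Expanded in the eigenbases `uᵢ` of `R` and `vⱼ` of `T`, the right-hand side of this form of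
Klein's inequality is the average of the pointwise expressions with the weights `‖⟨uᵢ, vⱼ⟩‖²`. -/
theorem sum_re_trace_cfc_mul_cfc_nonneg {ι : Type*} [Fintype ι] {R T : Matrix n n ℂ}
    (hR : R.IsHermitian) (hT : T.IsHermitian) {f g : ι → ℝ → ℝ}
    (hfg : ∀ x ∈ spectrum ℝ R, ∀ y ∈ spectrum ℝ T, 0 ≤ ∑ k, f k x * g k y) :
    0 ≤ ∑ k, (cfc (f k) R * cfc (g k) T).trace.re := by
  simp only [cfc_eq_conjDiagonal hR, cfc_eq_conjDiagonal hT, trace_conjDiagonal_mul_conjDiagonal,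
    ← Complex.ofReal_mul, ← Complex.ofReal_sum, Complex.ofReal_re]
  rw [Finset.sum_comm]
  refine Finset.sum_nonneg fun i _ => ?_
  rw [Finset.sum_comm]
  refine Finset.sum_nonneg fun j _ => ?_
  rw [← Finset.mul_sum]
  exact mul_nonneg (Complex.normSq_nonneg _) (hfg _ (hR.eigenvalues_mem_spectrum_real i) _
    (hT.eigenvalues_mem_spectrum_real j))

end Trace

section Entropy

variable {n : Type*} [Fintype n] [DecidableEq n]

/-- The cross entropy `-Tr σ log τ` of `σ` relative to the reference operator `τ`, in bits. For
singular `τ` it is a junk value, since `Real.logb 2 0 = 0`. -/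
def crossEntropy (σ τ : Matrix n n ℂ) : ℝ :=
  -(σ * cfc (Real.logb 2) τ).trace.re

theorem mul_logb_sub_mul_logb_nonneg {x y : ℝ} (hx : 0 ≤ x) (hy : 0 < y) :
    0 ≤ x * Real.logb 2 x - x * Real.logb 2 y + (Real.log 2)⁻¹ * (y - x) := by
  rcases hx.eq_or_lt with rfl | hx
  · have := Real.log_nonneg one_le_two
    simp only [zero_mul, sub_zero, zero_add]
    positivity
  · have hlog := mul_le_mul_of_nonneg_left (Real.log_le_sub_one_of_pos (div_pos hy hx)) hx.le
    rw [Real.log_div hy.ne' hx.ne', mul_sub, mul_sub, mul_div_cancel₀ _ hx.ne', mul_one] at hlog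
    have : 0 ≤ (Real.log 2)⁻¹ * (y - x - (x * Real.log y - x * Real.log x)) :=
      mul_nonneg (inv_nonneg.2 (Real.log_nonneg one_le_two)) (sub_nonneg.2 hlog)
    rw [Real.logb, Real.logb]
    linear_combination this

theorem entropy_le_crossEntropy {R T : Matrix n n ℂ} (hR : R.PosSemidef) (hT : T.PosDef)
    (htr : T.trace.re ≤ R.trace.re) : entropy R ≤ crossEntropy R T := by
  have hlog2 : 0 ≤ (Real.log 2)⁻¹ := inv_nonneg.2 (Real.log_nonneg one_le_two)
  have key := sum_re_trace_cfc_mul_cfc_nonneg hR.isHermitian hT.isHermitian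
    (f := ![fun x => x * Real.logb 2 x - (Real.log 2)⁻¹ * x, fun x => -x, fun _ => 1])
    (g := ![fun _ => 1, Real.logb 2, fun y => (Real.log 2)⁻¹ * y])
    fun x hx y hy => by
      have hxy := mul_logb_sub_mul_logb_nonneg (spectrum_nonneg_of_nonneg hR.nonneg hx)
        ((Matrix.isStrictlyPositive_iff_posDef.2 hT).spectrum_pos hy)
      simp only [Fin.sum_univ_three, Matrix.cons_val]
      linear_combination hxy
  have hcont (f : ℝ → ℝ) : ContinuousOn f (spectrum ℝ R) := R.finite_real_spectrum.continuousOn f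
  simp only [Fin.sum_univ_three, Matrix.cons_val] at key
  rw [cfc_sub _ _ R (hcont _) (hcont _), ← mul_cfc hR.isHermitian, cfc_const_mul_id _ R,
    cfc_const_mul_id _ T, cfc_neg_id (R := ℝ) R hR.isHermitian.isSelfAdjoint,
    cfc_const_one ℝ R, cfc_const_one ℝ T, mul_one, one_mul, neg_mul, Matrix.trace_sub,
    Matrix.trace_neg, Matrix.trace_smul, Matrix.trace_smul, Complex.sub_re, Complex.neg_re,
    Complex.smul_re, Complex.smul_re] at key
  rw [entropy, crossEntropy]
  have := mul_le_mul_of_nonneg_left htr hlog2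
  simp only [smul_eq_mul] at key
  linarith

end Entropy

section Surprisal

variable {n : Type*} [Fintype n] [DecidableEq n]

theorem isHermitian_msqrt (ρ : Matrix n n ℂ) : (msqrt ρ).IsHermitian :=
  cfc_predicate (R := ℝ) (p := IsSelfAdjoint) Real.sqrt ρ

theorem msqrt_mul_msqrt {ρ : Matrix n n ℂ} (hρ : ρ.PosSemidef) : msqrt ρ * msqrt ρ = ρ := by
  have hcont := ρ.finite_real_spectrum.continuousOn Real.sqrt
  rw [msqrt, ← cfc_mul _ _ ρ hcont hcont]
  refine (cfc_congr fun x hx => ?_).trans (cfc_id' ℝ ρ hρ.isHermitian.isSelfAdjoint)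
  exact Real.mul_self_sqrt (spectrum_nonneg_of_nonneg hρ.nonneg hx)

theorem posSemidef_msqrt_conj (ρ : Matrix n n ℂ) {N : Matrix n n ℂ} (hN : N.PosSemidef) :
    (msqrt ρ * N * msqrt ρ).PosSemidef := by
  simpa only [(isHermitian_msqrt ρ).eq] using hN.mul_mul_conjTranspose_same (msqrt ρ)

theorem trace_msqrt_conj {ρ : Matrix n n ℂ} (hρ : ρ.PosSemidef) (N : Matrix n n ℂ) :
    (msqrt ρ * N * msqrt ρ).trace = (ρ * N).trace := by
  rw [Matrix.trace_mul_comm, ← mul_assoc, msqrt_mul_msqrt hρ]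

theorem crossEntropy_smul (c : ℝ) (σ τ : Matrix n n ℂ) :
    crossEntropy (c • σ) τ = c * crossEntropy σ τ := by
  rw [crossEntropy, crossEntropy, smul_mul_assoc, Matrix.trace_smul, Complex.smul_re, smul_eq_mul,
    mul_neg]

/-- The observable `√ρ (-log τ) √ρ`. Its expectation against a POVM element `a_j` is `λ_j` times
the cross entropy of the canonical state `ρ̂_j` relative to `τ`. -/
def surprisal (ρ τ : Matrix n n ℂ) : Matrix n n ℂ :=
  msqrt ρ * -cfc (Real.logb 2) τ * msqrt ρ

theorem re_trace_mul_surprisal (B ρ τ : Matrix n n ℂ) :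
    (B * surprisal ρ τ).trace.re = crossEntropy (msqrt ρ * B * msqrt ρ) τ := by
  rw [surprisal, ← mul_assoc, Matrix.trace_mul_comm, crossEntropy, ← Complex.neg_re,
    ← Matrix.trace_neg, mul_neg, mul_neg, mul_neg]
  simp only [mul_assoc]

theorem re_trace_surprisal {ρ : Matrix n n ℂ} (hρ : ρ.PosSemidef) (τ : Matrix n n ℂ) :
    (surprisal ρ τ).trace.re = crossEntropy ρ τ := by
  rw [← one_mul (surprisal ρ τ), re_trace_mul_surprisal, mul_one, msqrt_mul_msqrt hρ]

theorem surprisal_le_of_smul_le {ρ S T : Matrix n n ℂ} {c : ℝ} (hρ : ρ.PosSemidef) (hS : S.PosDef)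
    (hc : 0 < c) (hST : c • S ≤ T) : surprisal ρ T ≤ surprisal ρ S - Real.logb 2 c • ρ := by
  have hexpand : surprisal ρ S - Real.logb 2 c • ρ - surprisal ρ T = msqrt ρ *
      (cfc (Real.logb 2) T - (Real.logb 2 c • 1 + cfc (Real.logb 2) S)) * msqrt ρ := by
    simp only [surprisal, mul_sub, sub_mul, mul_add, add_mul, mul_neg, neg_mul, mul_smul_comm,
      smul_mul_assoc, mul_one, msqrt_mul_msqrt hρ]
    abel
  rw [Matrix.le_iff, hexpand]
  exact posSemidef_msqrt_conj ρ (Matrix.le_iff.1 (logb_smul_one_add_cfc_logb_le hS hc hST))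

theorem posSemidef_surprisal (ρ : Matrix n n ℂ) {τ : Matrix n n ℂ} (hτ : τ.PosSemidef)
    (hτ_tr : τ.trace.re ≤ 1) : (surprisal ρ τ).PosSemidef := by
  refine posSemidef_msqrt_conj ρ (Matrix.nonneg_iff_posSemidef.1 ?_)
  rw [← cfc_neg]
  refine cfc_nonneg fun x hx => neg_nonneg.2 ?_
  have hx' := spectrum_subset_Icc_of_trace_le_one hτ hτ_tr hx
  exact Real.logb_nonpos one_lt_two hx'.1 hx'.2

end Surprisal

section POVM

variable {κ n : Type*} [Fintype κ] [Fintype n] [DecidableEq n] {A : κ → Matrix n n ℂ}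

theorem IsPOVM.nonempty [Nonempty n] (hA : IsPOVM A) : Nonempty κ := by
  by_contra h
  rw [not_nonempty_iff] at h
  exact zero_ne_one (hA.sum_eq_one ▸ Finset.univ_eq_empty (α := κ) ▸ Finset.sum_empty.symm)

theorem IsPOVM.sum_re_trace_mul (hA : IsPOVM A) (X : Matrix n n ℂ) :
    ∑ μ, (A μ * X).trace.re = X.trace.re := by
  rw [← Complex.re_sum, ← Matrix.trace_sum, ← Finset.sum_mul, hA.sum_eq_one, one_mul]

/-- Klein's inequality for the uniform mixture of the `t μ`; monotonicity of the logarithm bounds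
the surprisal of the mixture by that of each of its terms, up to `log |κ|`. -/
theorem entropy_le_logb_card_add_sum {R : Matrix n n ℂ} (hR : R.PosSemidef) (hR_tr : R.trace = 1)
    (hA : IsPOVM A) {t : κ → Matrix n n ℂ} (ht : ∀ μ, (t μ).PosDef)
    (ht_tr : ∀ μ, (t μ).trace.re ≤ 1) :
    entropy R ≤ Real.logb 2 (Fintype.card κ) + ∑ μ, (A μ * surprisal R (t μ)).trace.re := by
  have := nonempty_of_trace_eq_one hR_tr
  have := hA.nonempty
  have hcard : (0 : ℝ) < Fintype.card κ := by exact_mod_cast Fintype.card_pos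
  set M : ℝ := (Fintype.card κ : ℝ)
  set T := ∑ μ, M⁻¹ • t μ with hT
  have hterm μ : (M⁻¹ • t μ).PosDef := (ht μ).smul (inv_pos.2 hcard)
  have hle μ : M⁻¹ • t μ ≤ T :=
    Finset.single_le_sum (f := fun μ => M⁻¹ • t μ) (fun ν _ => (hterm ν).posSemidef.nonneg)
      (Finset.mem_univ μ)
  have hT_tr : T.trace.re ≤ R.trace.re := by
    rw [hT, ← Finset.smul_sum, Matrix.trace_smul, Complex.smul_re, Matrix.trace_sum,
      Complex.re_sum, hR_tr, Complex.one_re, smul_eq_mul, inv_mul_le_one₀ hcard]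
    exact (Finset.sum_le_card_nsmul _ _ 1 fun μ _ => ht_tr μ).trans_eq (by simp [M])
  have hsurprisal μ : (A μ * surprisal R T).trace.re ≤
      (A μ * surprisal R (t μ)).trace.re + Real.logb 2 M * (A μ * R).trace.re := by
    have h := re_trace_mul_le_re_trace_mul (hA.posSemidef μ)
      (surprisal_le_of_smul_le hR (ht μ) (inv_pos.2 hcard) (hle μ))
    rwa [Real.logb_inv, neg_smul, sub_neg_eq_add, mul_add, mul_smul_comm, Matrix.trace_add,
      Matrix.trace_smul, Complex.add_re, Complex.smul_re, smul_eq_mul] at h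
  calc entropy R ≤ crossEntropy R T :=
        entropy_le_crossEntropy hR
          (Matrix.posDef_sum Finset.univ_nonempty fun μ _ => hterm μ) hT_tr
    _ = ∑ μ, (A μ * surprisal R T).trace.re := by
        rw [hA.sum_re_trace_mul, re_trace_surprisal hR]
    _ ≤ ∑ μ, ((A μ * surprisal R (t μ)).trace.re + Real.logb 2 M * (A μ * R).trace.re) :=
        Finset.sum_le_sum fun μ _ => hsurprisal μ
    _ = Real.logb 2 M + ∑ μ, (A μ * surprisal R (t μ)).trace.re := by
        rw [Finset.sum_add_distrib, ← Finset.mul_sum, hA.sum_re_trace_mul, hR_tr, Complex.one_re,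
          mul_one, add_comm]

end POVM

section Tensor

variable {l : ℕ} {n : Type*}

theorem tensor_conjTranspose (B : Fin l → Matrix n n ℂ) :
    (tensor B)ᴴ = tensor fun i => (B i)ᴴ := by
  ext x y
  simp [tensor, Matrix.conjTranspose_apply]

theorem tensor_mul [Fintype n] (B C : Fin l → Matrix n n ℂ) :
    tensor B * tensor C = tensor (B * C) := by
  ext x y
  simp only [Matrix.mul_apply, tensor, Matrix.of_apply, ← Finset.prod_mul_distrib, Pi.mul_apply]
  rw [Finset.prod_univ_sum, Fintype.piFinset_univ]

theorem trace_tensor [Fintype n] (B : Fin l → Matrix n n ℂ) :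
    (tensor B).trace = ∏ i, (B i).trace := by
  simp only [Matrix.trace, Matrix.diag_apply, tensor, Matrix.of_apply]
  rw [Finset.prod_univ_sum, Fintype.piFinset_univ]

theorem trace_tensor_update [Fintype n] {B : Fin l → Matrix n n ℂ} (hB : ∀ i, (B i).trace = 1)
    (k : Fin l) (Z : Matrix n n ℂ) : (tensor (Function.update B k Z)).trace = Z.trace := by
  rw [trace_tensor, Finset.prod_eq_single k (fun i _ hik => by simp [hik, hB i]) (by simp),
    Function.update_self]

theorem posSemidef_tensor [Finite n] {B : Fin l → Matrix n n ℂ} (hB : ∀ i, (B i).PosSemidef) :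
    (tensor B).PosSemidef := by
  classical
  cases nonempty_fintype n
  choose C hC using fun i => CStarAlgebra.nonneg_iff_eq_star_mul_self.1 (hB i).nonneg
  have h : tensor B = (tensor C)ᴴ * tensor C := by
    rw [tensor_conjTranspose, tensor_mul]
    exact congrArg tensor (funext hC)
  exact h ▸ Matrix.posSemidef_conjTranspose_mul_self (tensor C)

theorem re_trace_tensor_le_one [Fintype n] {B : Fin l → Matrix n n ℂ} (hB : ∀ i, (B i).PosSemidef)
    (hB_tr : ∀ i, (B i).trace.re ≤ 1) : (tensor B).trace.re ≤ 1 := by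
  have hnonneg i : 0 ≤ (B i).trace := (hB i).trace_nonneg
  have hre i : ((B i).trace.re : ℂ) = (B i).trace :=
    (Complex.eq_re_of_ofReal_le (r := 0) (by simpa using hnonneg i)).symm
  rw [trace_tensor, ← Finset.prod_congr rfl fun i _ => hre i, ← Complex.ofReal_prod,
    Complex.ofReal_re]
  exact Finset.prod_le_one (fun i _ => (Complex.nonneg_iff.1 (hnonneg i)).1) fun i _ => hB_tr i

theorem tensor_diagonal [DecidableEq n] (h : Fin l → n → ℂ) :
    tensor (fun i => Matrix.diagonal (h i)) = Matrix.diagonal fun x => ∏ i, h i (x i) := by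
  ext x y
  rcases eq_or_ne x y with rfl | hxy
  · simp [tensor]
  · obtain ⟨i, hi⟩ := Function.ne_iff.1 hxy
    rw [Matrix.diagonal_apply_ne _ hxy]
    exact Finset.prod_eq_zero (Finset.mem_univ i) (Matrix.diagonal_apply_ne _ hi)

theorem tensor_one [DecidableEq n] : tensor (1 : Fin l → Matrix n n ℂ) = 1 :=
  (tensor_diagonal fun _ _ => 1).trans (by simp)

theorem posDef_tensor [Finite n] {B : Fin l → Matrix n n ℂ} (hB : ∀ i, (B i).PosDef) :
    (tensor B).PosDef := by
  classical
  cases nonempty_fintype n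
  choose C hC using fun i => (hB i).isUnit.exists_right_inv
  refine (posSemidef_tensor fun i => (hB i).posSemidef).posDef_iff_isUnit.2
    (IsUnit.of_mul_eq_one (tensor C) ?_)
  rw [tensor_mul, ← tensor_one]
  exact congrArg tensor (funext hC)

variable [Fintype n] [DecidableEq n]

/-- The tensor product of unitaries, in the unitary group of the tensor product space. -/
def tensorUnitary (U : Fin l → Matrix.unitaryGroup n ℂ) : Matrix.unitaryGroup (Fin l → n) ℂ :=
  ⟨tensor fun i => (U i : Matrix n n ℂ), by
    rw [Matrix.mem_unitaryGroup_iff, Matrix.star_eq_conjTranspose, tensor_conjTranspose,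
      tensor_mul, ← tensor_one]
    exact congrArg tensor (funext fun i => Unitary.mul_star_self_of_mem (U i).2)⟩

theorem tensor_conjDiagonal (U : Fin l → Matrix.unitaryGroup n ℂ) (h : Fin l → n → ℂ) :
    tensor (fun i => conjDiagonal (U i) (h i)) =
      conjDiagonal (tensorUnitary U) fun x => ∏ i, h i (x i) := by
  rw [conjDiagonal_apply, ← tensor_diagonal, Matrix.star_eq_conjTranspose, tensorUnitary,
    tensor_conjTranspose, tensor_mul, tensor_mul]
  rfl

theorem cfc_tensor {ι : Type*} [Fintype ι] {B : Fin l → Matrix n n ℂ}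
    (hB : ∀ i, (B i).IsHermitian) {f : ℝ → ℝ} {g : ι → Fin l → ℝ → ℝ}
    (hfg : ∀ x : Fin l → ℝ, (∀ i, x i ∈ spectrum ℝ (B i)) →
      f (∏ i, x i) = ∑ k, ∏ i, g k i (x i)) :
    cfc f (tensor B) = ∑ k, tensor fun i => cfc (g k i) (B i) := by
  have hspec : tensor B = conjDiagonal (tensorUnitary fun i => (hB i).eigenvectorUnitary)
      fun x => ((∏ i, (hB i).eigenvalues (x i) : ℝ) : ℂ) := by
    simp only [Complex.ofReal_prod]
    rw [← tensor_conjDiagonal _ fun i s => ((hB i).eigenvalues s : ℂ)]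
    exact congrArg tensor (funext fun i => (hB i).spectral_theorem)
  simp only [cfc_eq_conjDiagonal (hB _), tensor_conjDiagonal]
  rw [hspec, cfc_conjDiagonal, ← map_sum]
  congr 1
  funext x
  rw [hfg _ fun i => (hB i).eigenvalues_mem_spectrum_real (x i), Finset.sum_apply]
  push_cast
  rfl

theorem msqrt_tensor {B : Fin l → Matrix n n ℂ} (hB : ∀ i, (B i).PosSemidef) :
    msqrt (tensor B) = tensor fun i => msqrt (B i) := by
  rw [msqrt, cfc_tensor (ι := Unit) (g := fun _ _ => Real.sqrt) fun i => (hB i).isHermitian]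
  · simp only [msqrt, Finset.univ_unique, Finset.sum_singleton]
  · intro x hx
    rw [Real.sqrt_prod _ fun i _ => spectrum_nonneg_of_nonneg (hB i).nonneg (hx i)]
    simp only [Finset.univ_unique, Finset.sum_singleton]

theorem neg_cfc_logb_tensor {B : Fin l → Matrix n n ℂ} (hB : ∀ i, (B i).PosDef) :
    -cfc (Real.logb 2) (tensor B) =
      ∑ k, tensor (Function.update 1 k (-cfc (Real.logb 2) (B k))) := by
  rw [← cfc_neg, cfc_tensor (g := fun k i x => if i = k then -Real.logb 2 x else 1)
    fun i => (hB i).isHermitian]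
  · refine Finset.sum_congr rfl fun k _ => congrArg tensor (funext fun i => ?_)
    rcases eq_or_ne i k with rfl | hik
    · simp [cfc_neg]
    · simp [hik, cfc_const_one ℝ (B i) (hB i).isHermitian.isSelfAdjoint]
  · intro x hx
    have hx0 i : x i ≠ 0 :=
      ((Matrix.isStrictlyPositive_iff_posDef.2 (hB i)).spectrum_pos (hx i)).ne'
    simp [Real.logb_prod _ _ fun i _ => hx0 i]

theorem surprisal_tensor {ρ τ : Fin l → Matrix n n ℂ} (hρ : ∀ i, (ρ i).PosSemidef)
    (hτ : ∀ i, (τ i).PosDef) :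
    surprisal (tensor ρ) (tensor τ) =
      ∑ k, tensor (Function.update ρ k (surprisal (ρ k) (τ k))) := by
  rw [surprisal, msqrt_tensor hρ, neg_cfc_logb_tensor hτ, Finset.mul_sum, Finset.sum_mul]
  refine Finset.sum_congr rfl fun k _ => ?_
  rw [tensor_mul, tensor_mul]
  congr 1
  funext i
  rcases eq_or_ne i k with rfl | hik
  · simp [surprisal]
  · simp [hik, msqrt_mul_msqrt (hρ i)]

theorem tensor_mul_cfc_logb_tensor {B : Fin l → Matrix n n ℂ} (hB : ∀ i, (B i).PosSemidef) :
    tensor B * cfc (Real.logb 2) (tensor B) =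
      ∑ k, tensor (Function.update B k (B k * cfc (Real.logb 2) (B k))) := by
  rw [mul_cfc (posSemidef_tensor hB).isHermitian,
    cfc_tensor (g := fun k i x => x * if i = k then Real.logb 2 x else 1)
      fun i => (hB i).isHermitian]
  · refine Finset.sum_congr rfl fun k _ => congrArg tensor (funext fun i => ?_)
    rcases eq_or_ne i k with rfl | hik
    · simp [mul_cfc (hB i).isHermitian]
    · simp [hik, cfc_id' ℝ (B i) (hB i).isHermitian.isSelfAdjoint]
  · intro x _
    simp only [Finset.prod_mul_distrib, Finset.prod_ite_eq', Finset.mem_univ, if_true,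
      ← Finset.mul_sum]
    rcases eq_or_ne (∏ i, x i) 0 with h0 | h0
    · rw [h0, zero_mul, zero_mul]
    · rw [Real.logb_prod _ _ (Finset.prod_ne_zero_iff.1 h0)]

theorem entropy_tensor {B : Fin l → Matrix n n ℂ} (hB : ∀ i, (B i).PosSemidef)
    (hB_tr : ∀ i, (B i).trace = 1) : entropy (tensor B) = ∑ k, entropy (B k) := by
  simp only [entropy, tensor_mul_cfc_logb_tensor hB, Matrix.trace_sum, trace_tensor_update hB_tr,
    Complex.re_sum, Finset.sum_neg_distrib]

end Tensor

section Marginal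

variable {l : ℕ} {n : Type*} [Fintype n] [DecidableEq n]

theorem mul_tensor_update_one_apply_self (B : Matrix (Fin l → n) (Fin l → n) ℂ) (k : Fin l)
    (Z : Matrix n n ℂ) (x : Fin l → n) :
    (B * tensor (Function.update 1 k Z)) x x = ∑ t, B x (Function.update x k t) * Z t (x k) := by
  rw [Matrix.mul_apply]
  symm
  refine Finset.sum_of_injOn (Function.update x k) (Function.update_injective x k).injOn
    (fun _ _ => Finset.mem_univ _) (fun y _ hy => ?_) (fun t _ => ?_)
  · obtain ⟨i, hik, hi⟩ : ∃ i, i ≠ k ∧ y i ≠ x i := by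
      by_contra! h
      exact hy ⟨y k, by simp, Function.update_eq_iff.2 ⟨rfl, fun i hik => (h i hik).symm⟩⟩
    have hzero : tensor (Function.update 1 k Z) y x = 0 :=
      Finset.prod_eq_zero (Finset.mem_univ i) (by
        rw [Function.update_of_ne hik, Pi.one_apply, Matrix.one_apply_ne hi])
    rw [hzero, mul_zero]
  · congr 1
    rw [tensor, Matrix.of_apply, Finset.prod_eq_single k (fun i _ hik => by simp [hik]) (by simp),
      Function.update_self, Function.update_self]

theorem trace_partialTrace_mul (k : Fin l) (B : Matrix (Fin l → n) (Fin l → n) ℂ)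
    (Z : Matrix n n ℂ) :
    (partialTrace k B * Z).trace = (B * tensor (Function.update 1 k Z)).trace := by
  simp only [Matrix.trace, Matrix.diag_apply, mul_tensor_update_one_apply_self]
  rw [← Finset.sum_fiberwise Finset.univ (fun x : Fin l → n => x k)]
  refine Finset.sum_congr rfl fun s _ => ?_
  simp only [Matrix.mul_apply, partialTrace, Matrix.of_apply, Finset.sum_mul]
  rw [Finset.sum_comm]
  refine Finset.sum_congr rfl fun x hx => ?_
  rw [(Finset.mem_filter.1 hx).2]

variable {κ J : Type*} [Fintype κ] [Fintype J] [DecidableEq J]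

theorem sum_trace_marginal_mul (ρ : Matrix n n ℂ) (A : κ → Matrix (Fin l → n) (Fin l → n) ℂ)
    (guess : κ → Fin l → J) (k : Fin l) (Z : J → Matrix n n ℂ) :
    ∑ j, (marginal ρ A guess k j * Z j).trace =
      ∑ μ, (A μ * tensor (Function.update (fun _ => ρ) k (Z (guess μ k)))).trace := by
  rw [← Finset.sum_fiberwise Finset.univ (fun μ => guess μ k)]
  refine Finset.sum_congr rfl fun j _ => ?_
  have hlocal : tensor (Function.update 1 k (Z j)) * tensor (Function.update (fun _ => ρ) k 1) =
      tensor (Function.update (fun _ => ρ) k (Z j)) := by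
    rw [tensor_mul, ← Function.update_mul, mul_one]
    exact congrArg (fun B => tensor (Function.update B k (Z j))) (one_mul fun _ => ρ)
  rw [marginal, trace_partialTrace_mul, mul_assoc, Matrix.trace_mul_comm, mul_assoc, hlocal,
    Finset.sum_mul, Matrix.trace_sum]
  refine Finset.sum_congr rfl fun μ hμ => ?_
  rw [(Finset.mem_filter.1 hμ).2]

theorem mul_entropy_le_logb_card_add_sum {ρ : Matrix n n ℂ} (hρ : ρ.PosSemidef)
    (hρ_tr : ρ.trace = 1) {A : κ → Matrix (Fin l → n) (Fin l → n) ℂ} (hA : IsPOVM A)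
    (guess : κ → Fin l → J) {τ : J → Matrix n n ℂ} (hτ : ∀ j, (τ j).PosDef)
    (hτ_tr : ∀ j, (τ j).trace.re ≤ 1) :
    l * entropy ρ ≤ Real.logb 2 (Fintype.card κ) +
      ∑ k, ∑ j, (marginal ρ A guess k j * surprisal ρ (τ j)).trace.re := by
  have hpower : entropy (tensor fun _ : Fin l => ρ) = l * entropy ρ := by
    rw [entropy_tensor (fun _ => hρ) fun _ => hρ_tr, Finset.sum_const, Finset.card_univ,
      Fintype.card_fin, nsmul_eq_mul]
  have htr : (tensor fun _ : Fin l => ρ).trace = 1 := by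
    rw [trace_tensor, Finset.prod_eq_one fun _ _ => hρ_tr]
  have hsum : ∑ μ, (A μ * surprisal (tensor fun _ => ρ) (tensor fun k => τ (guess μ k))).trace.re =
      ∑ k, ∑ j, (marginal ρ A guess k j * surprisal ρ (τ j)).trace.re := by
    simp only [surprisal_tensor (fun _ => hρ) fun k => hτ (guess _ k), Finset.mul_sum,
      Matrix.trace_sum, ← Complex.re_sum]
    rw [Finset.sum_comm]
    simp only [sum_trace_marginal_mul ρ A guess _ fun j => surprisal ρ (τ j)]
  rw [← hpower, ← hsum]
  exact entropy_le_logb_card_add_sum (posSemidef_tensor fun _ => hρ) htr hA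
    (fun μ => posDef_tensor fun k => hτ (guess μ k))
    fun μ => re_trace_tensor_le_one (fun k => (hτ _).posSemidef) fun k => hτ_tr _

end Marginal

section Depolarize

variable {n : Type*} [Fintype n] [DecidableEq n]

/-- The output of the depolarizing channel with parameter `δ` on a state `σ`: mixing in the
maximally mixed state bounds the operator from below, hence its surprisal from above. -/
def depolarize (δ : ℝ) (σ : Matrix n n ℂ) : Matrix n n ℂ :=
  (1 - δ) • σ + (δ / Fintype.card n) • 1

variable {δ : ℝ} {σ : Matrix n n ℂ}

theorem cfc_depolarize (δ : ℝ) (hσ : σ.IsHermitian) (f : ℝ → ℝ) :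
    cfc f (depolarize δ σ) = cfc (fun x => f ((1 - δ) * x + δ / Fintype.card n)) σ := by
  have hsa := hσ.isSelfAdjoint
  have h : depolarize δ σ = cfc (fun x => (1 - δ) * x + δ / Fintype.card n) σ := by
    rw [cfc_add_const _ _ σ, cfc_const_mul_id _ σ, depolarize, Algebra.algebraMap_eq_smul_one]
  rw [h]
  exact (cfc_comp f _ σ (hg := (σ.finite_real_spectrum.image _).continuousOn f)).symm

theorem smul_one_le_depolarize (hσ : σ.PosSemidef) (hδ : δ ≤ 1) :
    (δ / Fintype.card n) • 1 ≤ depolarize δ σ :=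
  le_add_of_nonneg_left (hσ.smul (sub_nonneg.2 hδ)).nonneg

theorem posDef_depolarize [Nonempty n] (hσ : σ.PosSemidef) (hδ₀ : 0 < δ) (hδ₁ : δ ≤ 1) :
    (depolarize δ σ).PosDef :=
  Matrix.PosDef.posSemidef_add (hσ.smul (sub_nonneg.2 hδ₁))
    (Matrix.PosDef.one.smul (div_pos hδ₀ (Nat.cast_pos.2 Fintype.card_pos)))

theorem re_trace_depolarize_le_one [Nonempty n] (hσ_tr : σ.trace.re ≤ 1) (hδ : δ ≤ 1) :
    (depolarize δ σ).trace.re ≤ 1 := by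
  have hcard : (Fintype.card n : ℝ) ≠ 0 := Nat.cast_ne_zero.2 Fintype.card_ne_zero
  rw [depolarize, Matrix.trace_add, Matrix.trace_smul, Matrix.trace_smul, Matrix.trace_one,
    Complex.add_re, Complex.smul_re, Complex.smul_re, Complex.natCast_re, smul_eq_mul, smul_eq_mul,
    div_mul_cancel₀ _ hcard]
  linarith [mul_le_mul_of_nonneg_left hσ_tr (sub_nonneg.2 hδ)]

theorem re_trace_surprisal_depolarize_le [Nonempty n] {ρ : Matrix n n ℂ} (hρ : ρ.PosSemidef)
    (hρ_tr : ρ.trace = 1) (hσ : σ.PosSemidef) (hδ₀ : 0 < δ) (hδ₁ : δ ≤ 1) :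
    (surprisal ρ (depolarize δ σ)).trace.re ≤ Real.logb 2 (Fintype.card n / δ) := by
  have hone : surprisal ρ 1 = 0 := by
    rw [surprisal, cfc_apply_one, Real.logb_one, map_zero, neg_zero, mul_zero, zero_mul]
  have hle := surprisal_le_of_smul_le hρ Matrix.PosDef.one
    (div_pos hδ₀ (Nat.cast_pos.2 Fintype.card_pos)) (smul_one_le_depolarize hσ hδ₁)
  rw [hone, zero_sub, ← neg_smul, ← Real.logb_inv, inv_div] at hle
  have htr := re_trace_mul_le_re_trace_mul Matrix.PosSemidef.one hle
  rwa [one_mul, one_mul, Matrix.trace_smul, hρ_tr, Complex.smul_re, Complex.one_re, smul_eq_mul,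
    mul_one] at htr

theorem crossEntropy_depolarize_le [Nonempty n] (hσ : σ.PosSemidef) (hσ_tr : σ.trace.re ≤ 1)
    (hδ₀ : 0 < δ) (hδ₁ : δ ≤ 1) :
    crossEntropy σ (depolarize δ σ) ≤
      entropy σ - Real.logb 2 (1 - δ + δ / Fintype.card n) := by
  have hcard : (1 : ℝ) ≤ Fintype.card n := Nat.one_le_cast.2 Fintype.card_pos
  have hδcard : 0 < δ / Fintype.card n := by positivity
  set c := 1 - δ + δ / Fintype.card n with hc
  have hc₀ : 0 < c := by linarith [hc]
  have hc₁ : c ≤ 1 := by linarith [div_le_self hδ₀.le hcard]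
  have hpointwise : ∀ x ∈ spectrum ℝ σ, x * Real.logb 2 x + Real.logb 2 c * x ≤
      x * Real.logb 2 ((1 - δ) * x + δ / Fintype.card n) := by
    intro x hx
    obtain ⟨hx₀, hx₁⟩ := spectrum_subset_Icc_of_trace_le_one hσ hσ_tr hx
    rcases hx₀.eq_or_lt with rfl | hx₀
    · simp
    · rw [mul_comm (Real.logb 2 c), ← mul_add, ← Real.logb_mul hx₀.ne' hc₀.ne']
      refine mul_le_mul_of_nonneg_left (Real.logb_le_logb_of_le one_lt_two (by positivity) ?_)
        hx₀.le
      linarith [mul_le_mul_of_nonneg_right hx₁ hδcard.le]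
  have hcont (f : ℝ → ℝ) : ContinuousOn f (spectrum ℝ σ) := σ.finite_real_spectrum.continuousOn f
  have hle := cfc_mono hpointwise (hcont _) (hcont _)
  rw [cfc_add _ _ _ (hcont _) (hcont _), ← mul_cfc hσ.isHermitian, ← mul_cfc hσ.isHermitian,
    cfc_const_mul_id _ σ hσ.isHermitian.isSelfAdjoint, ← cfc_depolarize δ hσ.isHermitian] at hle
  have htr := re_trace_mul_le_re_trace_mul Matrix.PosSemidef.one hle
  rw [one_mul, one_mul, Matrix.trace_add, Matrix.trace_smul, Complex.add_re, Complex.smul_re,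
    smul_eq_mul] at htr
  rw [crossEntropy, entropy]
  linarith [mul_le_mul_of_nonpos_left hσ_tr (Real.logb_nonpos one_lt_two hc₀.le hc₁)]

end Depolarize

section Ensemble

variable {n J : Type*} [Fintype n] {ρ : Matrix n n ℂ} {a : J → Matrix n n ℂ}

theorem outcomeProb_nonneg (hρ : ρ.PosSemidef) {j : J} (ha : (a j).PosSemidef) :
    0 ≤ outcomeProb ρ a j :=
  re_trace_mul_nonneg hρ ha

theorem minProb_nonneg (hρ : ρ.PosSemidef) (ha : ∀ j, (a j).PosSemidef) : 0 ≤ minProb ρ a :=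
  Real.iInf_nonneg fun j => outcomeProb_nonneg hρ (ha j)

variable [DecidableEq n]

theorem sum_outcomeProb [Fintype J] (hρ_tr : ρ.trace = 1) (ha : IsPOVM a) :
    ∑ j, outcomeProb ρ a j = 1 := by
  simp only [outcomeProb, Matrix.trace_mul_comm ρ, ha.sum_re_trace_mul, hρ_tr, Complex.one_re]

theorem minProb_le_one [Fintype J] (hρ : ρ.PosSemidef) (hρ_tr : ρ.trace = 1) (ha : IsPOVM a) :
    minProb ρ a ≤ 1 := by
  have := nonempty_of_trace_eq_one hρ_tr
  have hnonneg j := outcomeProb_nonneg hρ (ha.posSemidef j)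
  obtain ⟨j⟩ := ha.nonempty
  calc minProb ρ a ≤ outcomeProb ρ a j := ciInf_le (Set.finite_range _).bddBelow j
    _ ≤ ∑ i, outcomeProb ρ a i :=
        Finset.single_le_sum (fun i _ => hnonneg i) (Finset.mem_univ j)
    _ = 1 := sum_outcomeProb hρ_tr ha

theorem posSemidef_canonicalState (hρ : ρ.PosSemidef) {j : J} (ha : (a j).PosSemidef) :
    (canonicalState ρ a j).PosSemidef :=
  (posSemidef_msqrt_conj ρ ha).smul (inv_nonneg.2 (outcomeProb_nonneg hρ ha))

theorem re_trace_canonicalState_le_one (hρ : ρ.PosSemidef) (j : J) :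
    (canonicalState ρ a j).trace.re ≤ 1 := by
  rw [canonicalState, Matrix.trace_smul, trace_msqrt_conj hρ, Complex.smul_re]
  exact inv_mul_le_one

theorem outcomeProb_smul_canonicalState (hρ : ρ.PosSemidef) {j : J} (ha : (a j).PosSemidef) :
    outcomeProb ρ a j • canonicalState ρ a j = msqrt ρ * a j * msqrt ρ := by
  have hconj := posSemidef_msqrt_conj ρ ha
  rcases eq_or_ne (outcomeProb ρ a j) 0 with h0 | h0
  · have htr : (msqrt ρ * a j * msqrt ρ).trace = 0 :=
      Complex.ext ((congrArg Complex.re (trace_msqrt_conj hρ (a j))).trans h0)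
        (Complex.nonneg_iff.1 hconj.trace_nonneg).2.symm
    rw [h0, zero_smul, hconj.trace_eq_zero_iff.1 htr]
  · rw [canonicalState, smul_inv_smul₀ h0]

theorem re_trace_mul_surprisal_eq_outcomeProb_mul (hρ : ρ.PosSemidef) {j : J}
    (ha : (a j).PosSemidef) (τ : Matrix n n ℂ) :
    (a j * surprisal ρ τ).trace.re =
      outcomeProb ρ a j * crossEntropy (canonicalState ρ a j) τ := by
  rw [re_trace_mul_surprisal, ← outcomeProb_smul_canonicalState hρ ha, crossEntropy_smul]

end Ensemble

section RateBound

/-- The rate lost, per copy of a `d`-dimensional system, when the POVM is only simulated up to an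
error `ε` and the canonical states are depolarized with parameter `δ` to keep their surprisal
bounded: the error costs `ε log (d / δ)`, the depolarization `-log (1 - δ + δ / d)`. -/
def depolarizingLoss (d ε δ : ℝ) : ℝ :=
  ε * Real.logb 2 (d / δ) - Real.logb 2 (1 - δ + δ / d)

variable {n J : Type*} [Fintype n] [DecidableEq n] [Fintype J] {ρ : Matrix n n ℂ}
  {a : J → Matrix n n ℂ} {ε δ : ℝ}

theorem sum_re_trace_mul_surprisal_depolarize_le (hρ : ρ.PosSemidef) (hρ_tr : ρ.trace = 1)
    (ha : IsPOVM a) (hδ₀ : 0 < δ) (hδ₁ : δ ≤ 1) {B : J → Matrix n n ℂ}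
    (hB : ∑ j, opNorm (B j - a j) ≤ ε) :
    ∑ j, (B j * surprisal ρ (depolarize δ (canonicalState ρ a j))).trace.re ≤
      ∑ j, outcomeProb ρ a j * entropy (canonicalState ρ a j) +
        depolarizingLoss (Fintype.card n) ε δ := by
  have := nonempty_of_trace_eq_one hρ_tr
  have hσ j := posSemidef_canonicalState hρ (ha.posSemidef j)
  have hσ_tr := re_trace_canonicalState_le_one (a := a) hρ
  set S := fun j => surprisal ρ (depolarize δ (canonicalState ρ a j))
  have hS j : (S j).PosSemidef :=
    posSemidef_surprisal ρ (posDef_depolarize (hσ j) hδ₀ hδ₁).posSemidef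
      (re_trace_depolarize_le_one (hσ_tr j) hδ₁)
  have hlog : 0 ≤ Real.logb 2 (Fintype.card n / δ) :=
    Real.logb_nonneg one_lt_two ((one_le_div hδ₀).2
      (hδ₁.trans (Nat.one_le_cast.2 Fintype.card_pos)))
  have herror := sum_re_trace_mul_le_mul hB hS
    (fun j => re_trace_surprisal_depolarize_le hρ hρ_tr (hσ j) hδ₀ hδ₁) hlog
  have hexact : ∑ j, (a j * S j).trace.re ≤
      ∑ j, outcomeProb ρ a j * entropy (canonicalState ρ a j) -
        Real.logb 2 (1 - δ + δ / Fintype.card n) :=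
    calc ∑ j, (a j * S j).trace.re
        ≤ ∑ j, outcomeProb ρ a j * (entropy (canonicalState ρ a j) -
            Real.logb 2 (1 - δ + δ / Fintype.card n)) := by
          refine Finset.sum_le_sum fun j _ => ?_
          rw [re_trace_mul_surprisal_eq_outcomeProb_mul hρ (ha.posSemidef j)]
          exact mul_le_mul_of_nonneg_left (crossEntropy_depolarize_le (hσ j) (hσ_tr j) hδ₀ hδ₁)
            (outcomeProb_nonneg hρ (ha.posSemidef j))
      _ = _ := by
          simp only [mul_sub, Finset.sum_sub_distrib, ← Finset.sum_mul, sum_outcomeProb hρ_tr ha,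
            one_mul]
  simp only [sub_mul, Matrix.trace_sub, Complex.sub_re, Finset.sum_sub_distrib] at herror
  rw [depolarizingLoss]
  linarith

theorem two_rpow_mul_entropyDefect_sub_depolarizingLoss_le_card [DecidableEq J] {l : ℕ}
    {κ : Type*} [Fintype κ] (hρ : ρ.PosSemidef) (hρ_tr : ρ.trace = 1) (ha : IsPOVM a)
    (hδ₀ : 0 < δ) (hδ₁ : δ ≤ 1) {A : κ → Matrix (Fin l → n) (Fin l → n) ℂ} (hA : IsPOVM A)
    {guess : κ → Fin l → J} (hclose : ∀ k, ∑ j, opNorm (marginal ρ A guess k j - a j) ≤ ε) :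
    (2 : ℝ) ^ (l * (entropyDefect ρ a - depolarizingLoss (Fintype.card n) ε δ)) ≤
      Fintype.card κ := by
  have := nonempty_of_trace_eq_one hρ_tr
  have := hA.nonempty
  have hσ j := posSemidef_canonicalState hρ (ha.posSemidef j)
  have hbound := mul_entropy_le_logb_card_add_sum hρ hρ_tr hA guess
    (fun j => posDef_depolarize (hσ j) hδ₀ hδ₁)
    fun j => re_trace_depolarize_le_one (re_trace_canonicalState_le_one hρ j) hδ₁
  have hsites := Finset.sum_le_sum fun k (_ : k ∈ Finset.univ) =>
    sum_re_trace_mul_surprisal_depolarize_le hρ hρ_tr ha hδ₀ hδ₁ (hclose k)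
  rw [Finset.sum_const, Finset.card_univ, Fintype.card_fin, nsmul_eq_mul] at hsites
  rw [← Real.le_logb_iff_rpow_le one_lt_two (Nat.cast_pos.2 Fintype.card_pos), entropyDefect]
  linarith

end RateBound

section RateEstimates

theorem neg_logb_two_one_sub_le {x : ℝ} (hx₀ : 0 ≤ x) (hx₁ : x ≤ 1 / 2) :
    -Real.logb 2 (1 - x) ≤ 2 * x := by
  have hchord := strictConcaveOn_log_Ioi.concaveOn.2 (show (1 / 2 : ℝ) ∈ Set.Ioi 0 by norm_num)
    (show (1 : ℝ) ∈ Set.Ioi 0 by norm_num) (show 0 ≤ 2 * x by linarith)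
    (show 0 ≤ 1 - 2 * x by linarith) (by ring)
  simp only [smul_eq_mul, Real.log_one, mul_zero, add_zero, one_div, Real.log_inv] at hchord
  rw [show 2 * x * 2⁻¹ + (1 - 2 * x) * 1 = 1 - x by ring] at hchord
  rw [Real.logb, ← neg_div, div_le_iff₀ (Real.log_pos one_lt_two)]
  linarith

theorem one_sub_inv_le_logb_two {x : ℝ} (hx : 1 ≤ x) : 1 - x⁻¹ ≤ Real.logb 2 x := by
  have hlog2 : Real.log 2 ≤ 1 := Real.log_two_lt_d9.le.trans (by norm_num)
  exact (Real.one_sub_inv_le_log_of_pos (by linarith)).trans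
    (le_div_self (Real.log_nonneg hx) (Real.log_pos one_lt_two) hlog2)

theorem depolarizingLoss_two_mul_le {d ε u : ℝ} (hd : 1 ≤ d) (hu₀ : 0 < u) (hu₁ : u ≤ 1 / 4)
    (hε : ε ≤ u) : depolarizingLoss d ε (2 * u) ≤ -(3 * u * Real.logb 2 (2 * u / d)) := by
  have hd₀ : 0 < d := by linarith
  have hinv₀ : 0 < d⁻¹ := inv_pos.2 hd₀
  have hinv₁ : d⁻¹ ≤ 1 := inv_le_one_of_one_le₀ hd
  set L := Real.logb 2 (d / (2 * u)) with hL
  have hneg : Real.logb 2 (2 * u / d) = -L := by rw [hL, ← Real.logb_inv, inv_div]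
  have hlog_u : 1 ≤ -Real.logb 2 (2 * u) := by
    have h := Real.logb_le_logb_of_le one_lt_two (by linarith : 0 < 2 * u)
      (by linarith : 2 * u ≤ 2⁻¹)
    rw [Real.logb_inv, Real.logb_self_eq_one one_lt_two] at h
    linarith
  have hL_ge : 2 * (1 - d⁻¹) ≤ L := by
    rw [hL, Real.logb_div hd₀.ne' (by positivity)]
    linarith [one_sub_inv_le_logb_two hd]
  have hx₀ : 0 ≤ 2 * u * (1 - d⁻¹) := mul_nonneg (by linarith) (by linarith)
  have hx₁ : 2 * u * (1 - d⁻¹) ≤ 1 / 2 := by nlinarith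
  have hloss := neg_logb_two_one_sub_le hx₀ hx₁
  rw [show 1 - 2 * u * (1 - d⁻¹) = 1 - 2 * u + 2 * u / d by ring] at hloss
  rw [depolarizingLoss, hneg]
  have hεL : ε * L ≤ u * L := mul_le_mul_of_nonneg_right hε (by linarith)
  linarith [mul_le_mul_of_nonneg_left hL_ge (by linarith : 0 ≤ 2 * u)]

theorem tendsto_depolarizingLoss {d : ℝ} (hd : d ≠ 0) :
    Filter.Tendsto (fun ε => depolarizingLoss d ε ε) (nhdsWithin 0 (Set.Ioi 0)) (nhds 0) := by
  have hcont : ContinuousAt (fun ε : ℝ => (ε * Real.log d - ε * Real.log ε) / Real.log 2 -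
      Real.log (1 - ε + ε / d) / Real.log 2) 0 := by
    have := Real.continuous_mul_log.continuousAt (x := 0)
    fun_prop (disch := simp)
  have hlim := hcont.tendsto.mono_left (nhdsWithin_le_nhds (s := Set.Ioi 0))
  simp only [zero_mul, sub_zero, zero_div, add_zero, Real.log_one] at hlim
  refine hlim.congr' (eventually_nhdsWithin_of_forall fun ε hε => ?_)
  dsimp only
  rw [depolarizingLoss, Real.logb, Real.logb, Real.log_div hd (ne_of_gt hε), ← mul_sub,
    mul_div_assoc]

end RateEstimates

end MeasurementCompression

end

open MeasurementCompression in
theorem theorem3_general {n J : Type*} [Fintype n] [DecidableEq n] [Fintype J] [DecidableEq J]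
    {ρ : Matrix n n ℂ} (hρ : ρ.PosSemidef) (hρ_tr : ρ.trace = 1)
    {a : J → Matrix n n ℂ} (ha : IsPOVM a) :
    (∀ ε : ℝ, 0 < ε → ε ≤ (minProb ρ a / 2) ^ 2 →
      ∀ (l : ℕ) {κ : Type*} [Fintype κ] (A : κ → Matrix (Fin l → n) (Fin l → n) ℂ)
        (guess : κ → Fin l → J),
        IsPOVM A → (∀ k, ∑ j, opNorm (marginal ρ A guess k j - a j) ≤ ε) →
        (2 : ℝ) ^ (l * (entropyDefect ρ a + 3 * ε / minProb ρ a ^ 2 *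
          Real.logb 2 (2 * ε / (minProb ρ a ^ 2 * Fintype.card n)))) ≤ Fintype.card κ) ∧
    (∀ δ : ℝ, 0 < δ → ∃ ε₀ : ℝ, 0 < ε₀ ∧
      ∀ (l : ℕ) {κ : Type*} [Fintype κ] (A : κ → Matrix (Fin l → n) (Fin l → n) ℂ)
        (guess : κ → Fin l → J),
        IsPOVM A → (∀ k, ∑ j, opNorm (marginal ρ A guess k j - a j) ≤ ε₀) →
        (2 : ℝ) ^ (l * (entropyDefect ρ a - δ)) ≤ Fintype.card κ) := by
  have := nonempty_of_trace_eq_one hρ_tr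
  have hd : (1 : ℝ) ≤ Fintype.card n := Nat.one_le_cast.2 Fintype.card_pos
  refine ⟨fun ε hε₀ hε l κ _ A guess hA hclose => ?_, fun δ hδ => ?_⟩
  · have hmin_sq : 0 < minProb ρ a ^ 2 := by linarith [div_pow (minProb ρ a) 2 2]
    have hu₀ : 0 < ε / minProb ρ a ^ 2 := div_pos hε₀ hmin_sq
    have hu₁ : ε / minProb ρ a ^ 2 ≤ 1 / 4 := (div_le_iff₀ hmin_sq).2 (by linarith)
    have hloss := depolarizingLoss_two_mul_le hd hu₀ hu₁ (le_div_self hε₀.le hmin_sq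
      (pow_le_one₀ (minProb_nonneg hρ ha.posSemidef) (minProb_le_one hρ hρ_tr ha)))
    refine le_trans ?_ (two_rpow_mul_entropyDefect_sub_depolarizingLoss_le_card hρ hρ_tr ha
      (by linarith : 0 < 2 * (ε / minProb ρ a ^ 2)) (by linarith) hA hclose)
    rw [← mul_div_assoc, ← mul_div_assoc, div_div] at hloss
    gcongr
    · exact one_le_two
    · rw [← mul_div_assoc]
      linarith
  · obtain ⟨ε, hloss, hε₀, hε₁⟩ := (((tendsto_depolarizingLoss (zero_lt_one.trans_le
      hd).ne').eventually_lt_const hδ).and (Ioo_mem_nhdsGT one_pos)).exists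
    refine ⟨ε, hε₀, fun l κ _ A guess hA hclose => le_trans ?_
      (two_rpow_mul_entropyDefect_sub_depolarizingLoss_le_card hρ hρ_tr ha hε₀ hε₁.le hA hclose)⟩
    gcongr
    exact one_le_two

theorem theorem3 {d m : ℕ}
    (ρ : Matrix (Fin d) (Fin d) ℂ) (hρ : ρ.PosDef) (hρ_tr : ρ.trace = 1)
    (a : Fin m → Matrix (Fin d) (Fin d) ℂ) (ha : MeasurementCompression.IsPOVM a) :
    -- the lower bound on the number of outcomes
    (∀ ε : ℝ, 0 < ε → ε ≤ (MeasurementCompression.minProb ρ a / 2) ^ 2 →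
      ∀ (l M : ℕ) (A : Fin M → Matrix (Fin l → Fin d) (Fin l → Fin d) ℂ)
        (guess : Fin M → Fin l → Fin m),
        MeasurementCompression.IsPOVM A →
        (∀ k : Fin l, ∑ j : Fin m, MeasurementCompression.opNorm
          (MeasurementCompression.marginal ρ A guess k j - a j) ≤ ε) →
        (2 : ℝ) ^ ((l : ℝ) * (MeasurementCompression.entropyDefect ρ a +
            3 * ε / MeasurementCompression.minProb ρ a ^ 2 *
              Real.logb 2 (2 * ε / (MeasurementCompression.minProb ρ a ^ 2 * (d : ℝ))))) ≤ (M : ℝ)) ∧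
    -- asymptotic optimality: no rate below the entropy defect suffices for small errors
    (0 < MeasurementCompression.minProb ρ a →
      ∀ δ : ℝ, 0 < δ → ∃ ε₀ : ℝ, 0 < ε₀ ∧
      ∀ (l M : ℕ) (A : Fin M → Matrix (Fin l → Fin d) (Fin l → Fin d) ℂ)
        (guess : Fin M → Fin l → Fin m),
        MeasurementCompression.IsPOVM A →
        (∀ k : Fin l, ∑ j : Fin m, MeasurementCompression.opNorm
          (MeasurementCompression.marginal ρ A guess k j - a j) ≤ ε₀) →
        (2 : ℝ) ^ ((l : ℝ) * (MeasurementCompression.entropyDefect ρ a - δ)) ≤ (M : ℝ)) := by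
  have ⟨hbound, hoptimal⟩ := theorem3_general hρ.posSemidef hρ_tr ha
  exact ⟨fun ε hε₀ hε l M A => by simpa using hbound ε hε₀ hε l A, fun _ δ hδ =>
    (hoptimal δ hδ).imp fun ε₀ h => ⟨h.1, fun l M A => by simpa using h.2 l A⟩⟩
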